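/- Let $p$ be a prime and $k=\mathbb{F}_p$. There is an $r_0$, depending only on $p$, such that for every $2$-dimensional $k$-vector space $V$ and every $r\ge r_0$ the natural algebra homomorphism $$\rho\colon k\mathfrak{S}_r\longrightarrow \operatorname{End}_{GL(V)}(V^{\otimes r})$$ is not surjective. Here $GL(V)$ acts diagonally on $V^{\otimes r}$, by $g(x_1\otimes\cdots\otimes x_r)=gx_1\otimes\cdots\otimes gx_r$, and $\rho$ is the $k$-linear extension of the place permutation action $\sigma(x_1\otimes\cdots\otimes x_r)=x_{\sigma^{-1}(1)}\otimes\cdots\otimes x_{\sigma^{-1}(r)}$ of the symmetric group $\mathfrak{S}_r$, which commutes with the action of $GL(V)$. -/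

import Mathlib

open scoped TensorProduct

namespace SchurWeyl

noncomputable section

/-- The diagonal action of `GL(V)` on the tensor power `V^{⊗r}`:
`g (x₁ ⊗ ⋯ ⊗ x_r) = g x₁ ⊗ ⋯ ⊗ g x_r`. -/
def glRep (k : Type*) [Field k] (V : Type*) [AddCommGroup V] [Module k V] (r : ℕ) :
    Representation k (LinearMap.GeneralLinearGroup k V) (⨂[k]^r V) where
  toFun g := PiTensorProduct.map (fun _ : Fin r => (g : V →ₗ[k] V))
  map_one' := PiTensorProduct.map_one
  map_mul' _ _ := PiTensorProduct.map_mul _ _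

/-- The place permutation action of the symmetric group on `V^{⊗r}`:
`σ (x₁ ⊗ ⋯ ⊗ x_r) = x_{σ⁻¹ 1} ⊗ ⋯ ⊗ x_{σ⁻¹ r}`. -/
def permRep (k : Type*) [Field k] (V : Type*) [AddCommGroup V] [Module k V] (r : ℕ) :
    Representation k (Equiv.Perm (Fin r)) (⨂[k]^r V) where
  toFun σ := (PiTensorProduct.reindex k (fun _ : Fin r => V) σ).toLinearMap
  map_one' := by
    ext x
    simp
    rfl
  map_mul' σ τ := by
    ext x
    simp
    rfl

/-- The two actions on `V^{⊗r}` commute. -/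
theorem permRep_comm_glRep (k : Type*) [Field k] (V : Type*) [AddCommGroup V] [Module k V]
    (r : ℕ) (σ : Equiv.Perm (Fin r)) (g : LinearMap.GeneralLinearGroup k V) :
    permRep k V r σ ∘ₗ glRep k V r g = glRep k V r g ∘ₗ permRep k V r σ := by
  ext x
  simp [permRep, glRep]

/-- Place permutations as elements of the endomorphism algebra `End_{GL(V)}(V^{⊗r})`. -/
def permIntertwining (k : Type*) [Field k] (V : Type*) [AddCommGroup V] [Module k V] (r : ℕ) :
    Equiv.Perm (Fin r) →* (glRep k V r).IntertwiningMap (glRep k V r) where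
  toFun σ :=
    { toLinearMap := permRep k V r σ
      isIntertwining' := permRep_comm_glRep k V r σ }
  map_one' := by
    apply Representation.IntertwiningMap.ext
    exact map_one (permRep k V r)
  map_mul' σ τ := by
    apply Representation.IntertwiningMap.ext
    exact map_mul (permRep k V r) σ τ

/-- The natural algebra homomorphism `ρ : k S_r → End_{GL(V)}(V^{⊗r})`. -/
def rho (k : Type*) [Field k] (V : Type*) [AddCommGroup V] [Module k V] (r : ℕ) :
    MonoidAlgebra k (Equiv.Perm (Fin r)) →ₐ[k]
      (glRep k V r).IntertwiningMap (glRep k V r) :=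
  MonoidAlgebra.lift k _ (Equiv.Perm (Fin r)) (permIntertwining k V r)

end

end SchurWeyl

namespace SchurWeyl

open Matrix Module

section TensorCoordinates

variable {k : Type*} [Field k] {V : Type*} [AddCommGroup V] [Module k V] {r : ℕ} {ι : Type*}

/-! Operators in the image of `rho` have zero entries between basis tensors of different content
(`tensorCoord_rho_eq_zero`). Summing the conjugates of a rank-one operator over the finite group
`GL(V)` gives an equivariant operator, in any characteristic since nothing is divided by the group
order. For large `r` a suitable such sum has entry `1` from a tensor containing `e₁` to `e₀ ⊗ ⋯ ⊗
e₀`: `sum_GL_two` reduces this entry to a one-variable sum over `k`, and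
`exists_sum_pow_mul_pow_eq_neg_one` makes that sum `-1`. -/

/-- The coordinate functional `x₁ ⊗ ⋯ ⊗ x_r ↦ ∏ a, (x_a)_{K a}` on `V^{⊗r}`. -/
noncomputable def tensorCoord (b : Basis ι k V) (K : Fin r → ι) : (⨂[k]^r V) →ₗ[k] k :=
  PiTensorProduct.lift
    ((MultilinearMap.mkPiAlgebra k (Fin r) k).compLinearMap fun a => b.coord (K a))

theorem tensorCoord_tprod (b : Basis ι k V) (K : Fin r → ι) (x : Fin r → V) :
    tensorCoord b K (PiTensorProduct.tprod k x) = ∏ a, b.coord (K a) (x a) := by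
  simp [tensorCoord]

/-- Matrix entries of an element of the image of `k S_r` vanish between basis tensors that are not
place permutations of each other. -/
theorem tensorCoord_rho_eq_zero (b : Basis ι k V) {K L : Fin r → ι}
    (h : ∀ σ : Equiv.Perm (Fin r), L ∘ σ ≠ K) (x : MonoidAlgebra k (Equiv.Perm (Fin r))) :
    tensorCoord b K ((rho k V r x).toLinearMap (PiTensorProduct.tprod k fun a => b (L a))) = 0 := by
  induction x using MonoidAlgebra.induction_linear with
  | zero => simp
  | add f g hf hg =>
    rw [map_add, Representation.IntertwiningMap.add_toLinearMap, LinearMap.add_apply, map_add,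
      hf, hg, add_zero]
  | single σ c =>
    have hσ : ((rho k V r (MonoidAlgebra.single σ c)).toLinearMap
        (PiTensorProduct.tprod k fun a => b (L a))) =
        c • PiTensorProduct.tprod k fun a => b (L (σ.symm a)) := by
      simp [rho, MonoidAlgebra.lift_single, permIntertwining, permRep]
    rw [hσ, map_smul, tensorCoord_tprod]
    obtain ⟨a, ha⟩ := Function.ne_iff.1 (h σ.symm)
    rw [Finset.prod_eq_zero (Finset.mem_univ a), smul_zero]
    rw [b.coord_apply, b.repr_self, Finsupp.single_eq_of_ne]
    exact Ne.symm ha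

end TensorCoordinates

section Averaging

variable {k : Type*} [Field k] {V : Type*} [AddCommGroup V] [Module k V] {r : ℕ}
  {G : Type*} [Group G] [Fintype G]

/-- The average `∑ g, g ∘ E ∘ g⁻¹` of an endomorphism of `V^{⊗r}` over a finite group isomorphic
to `GL(V)`. -/
noncomputable def average (φ : G ≃* LinearMap.GeneralLinearGroup k V)
    (E : (⨂[k]^r V) →ₗ[k] ⨂[k]^r V) :
    (glRep k V r).IntertwiningMap (glRep k V r) where
  toLinearMap := ∑ g : G, glRep k V r (φ g) ∘ₗ E ∘ₗ glRep k V r (φ g⁻¹)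
  isIntertwining' h := by
    obtain ⟨h, rfl⟩ := φ.surjective h
    simp only [← Module.End.mul_eq_comp, Finset.sum_mul, Finset.mul_sum]
    refine Fintype.sum_equiv (Equiv.mulLeft h⁻¹) _ _ fun g => ?_
    simp only [Equiv.coe_mulLeft, _root_.mul_inv_rev, inv_inv, map_mul, mul_assoc]
    rw [← mul_assoc (glRep k V r (φ h)), ← map_mul (glRep k V r) (φ h), ← map_mul φ h,
      mul_inv_cancel, map_one, map_one,
      one_mul]

/-- The isomorphism between invertible matrices and linear automorphisms given by a basis. -/
noncomputable def basisGL {ι : Type*} [Fintype ι] [DecidableEq ι] (b : Basis ι k V) :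
    GL ι k ≃* LinearMap.GeneralLinearGroup k V :=
  Units.mapEquiv (Matrix.toLinAlgEquiv b).toMulEquiv

theorem coord_basisGL {ι : Type*} [Fintype ι] [DecidableEq ι] (b : Basis ι k V) (g : GL ι k)
    (i j : ι) :
    b.coord i ((basisGL b g : V →ₗ[k] V) (b j)) = (g : Matrix ι ι k) i j := by
  change b.coord i (Matrix.toLinAlgEquiv b (g : Matrix ι ι k) (b j)) = _
  simp [Matrix.toLinAlgEquiv_self, Finsupp.single_apply]

theorem tensorCoord_glRep {ι : Type*} [Fintype ι] [DecidableEq ι] (b : Basis ι k V) (g : GL ι k)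
    (K I : Fin r → ι) :
    tensorCoord b K (glRep k V r (basisGL b g) (PiTensorProduct.tprod k fun a => b (I a))) =
      ∏ a, (g : Matrix ι ι k) (K a) (I a) := by
  simp only [glRep, MonoidHom.coe_mk, OneHom.coe_mk, PiTensorProduct.map_tprod, tensorCoord_tprod,
    coord_basisGL]

theorem tensorCoord_average {ι : Type*} [Fintype ι] [DecidableEq ι] [Fintype k] [DecidableEq k]
    (b : Basis ι k V) (I J K L : Fin r → ι) :
    tensorCoord b K ((average (basisGL b) ((tensorCoord b J).smulRight
        (PiTensorProduct.tprod k fun a => b (I a)))).toLinearMap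
          (PiTensorProduct.tprod k fun a => b (L a))) =
      ∑ g : GL ι k, ∏ a, (g : Matrix ι ι k) (K a) (I a) *
        ((g⁻¹ : GL ι k) : Matrix ι ι k) (J a) (L a) := by
  simp only [average, LinearMap.sum_apply, map_sum, LinearMap.comp_apply,
    LinearMap.smulRight_apply, map_smul, tensorCoord_glRep, smul_eq_mul, Finset.prod_mul_distrib]
  exact Finset.sum_congr rfl fun g _ => mul_comm _ _

end Averaging

section FiniteField

variable {k : Type*} [Field k] [Fintype k] [DecidableEq k]

theorem sum_pow_of_pos {n : ℕ} (hn : 0 < n) :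
    ∑ x : k, x ^ n = if Fintype.card k - 1 ∣ n then -1 else 0 := by
  rw [← FiniteField.sum_pow_units, eq_comm]
  refine Finset.sum_of_injOn (fun u : kˣ => (u : k)) (fun _ _ _ _ h => Units.ext h) (by simp)
    (fun x _ hx => ?_) (fun _ _ => rfl)
  by_cases h : x = 0
  · simp [h, hn.ne']
  · exact absurd ⟨Units.mk0 x h, by simp⟩ hx

/-- In each degree at least `q`, some monomial in `x` and `1 - x` has sum `-1` over `𝔽_q`. -/
theorem exists_sum_pow_mul_pow_eq_neg_one {n : ℕ} (hn : Fintype.card k ≤ n) :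
    ∃ i j : ℕ, i + j = n ∧ ∑ x : k, x ^ i * (1 - x) ^ j = -1 := by
  have hq : 1 < Fintype.card k := Fintype.one_lt_card
  by_cases h : Fintype.card k - 1 ∣ n
  · exact ⟨n, 0, by simp, by simp [sum_pow_of_pos (show 0 < n by omega), h]⟩
  -- Here `x ^ (q - 1)` only removes the term `x = 0`, which is `1` in a power sum equal to `0`.
  · refine ⟨Fintype.card k - 1, n - (Fintype.card k - 1), by omega, ?_⟩
    have hj : ¬ Fintype.card k - 1 ∣ n - (Fintype.card k - 1) := fun hd =>
      h ((Nat.dvd_sub_iff_left (by omega) dvd_rfl).1 hd)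
    have hs : ∑ x : k, (1 - x) ^ (n - (Fintype.card k - 1)) = 0 := by
      refine ((Equiv.subLeft (1 : k)).sum_comp fun x => x ^ (n - (Fintype.card k - 1))).trans ?_
      rw [sum_pow_of_pos (by omega), if_neg hj]
    rw [← Finset.add_sum_erase _ _ (Finset.mem_univ (0 : k))] at hs ⊢
    rw [zero_pow (by omega), zero_mul, zero_add]
    rw [sub_zero, one_pow] at hs
    rw [← eq_neg_of_add_eq_zero_right hs]
    refine Finset.sum_congr rfl fun x hx => ?_
    rw [FiniteField.pow_card_sub_one_eq_one x (Finset.ne_of_mem_erase hx), one_mul]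

/-- Summing over `GL₂(𝔽_q)` a function supported on matrices with nonzero first row `(u, v)`,
`u v ≠ 0`, parametrised by `u`, `v`, the determinant `w` and `x = u d / w`. -/
theorem sum_GL_two (i j : ℕ) :
    ∑ g : GL (Fin 2) k,
      ((g.1 0 0 * (g⁻¹).1 0 1) ^ (Fintype.card k - 1) *
        ((g.1 0 0 * (g⁻¹).1 0 0) ^ i * (g.1 0 1 * (g⁻¹).1 1 0) ^ j)) =
      -∑ x : k, x ^ i * (1 - x) ^ j := by
  have hq : 1 < Fintype.card k := Fintype.one_lt_card
  have hdet : ∀ t : ((kˣ × kˣ) × kˣ) × k,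
      (!![(t.1.1.1 : k), t.1.1.2; (t.2 - 1) * t.1.2 / t.1.1.2, t.2 * t.1.2 / t.1.1.1]).det =
        t.1.2 := by
    rintro ⟨⟨⟨u, v⟩, w⟩, x⟩
    have hu := u.ne_zero
    have hv := v.ne_zero
    simp only [det_fin_two_of]
    field_simp
    ring
  -- The free units `u`, `v`, `w` contribute `(q - 1)³ = -1` in `k`.
  have key : ∑ t : ((kˣ × kˣ) × kˣ) × k, t.2 ^ i * (1 - t.2) ^ j =
      -∑ x : k, x ^ i * (1 - x) ^ j := by
    rw [Fintype.sum_prod_type]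
    simp [Fintype.card_units, Nat.cast_sub hq.le]
  rw [← key, eq_comm]
  refine Finset.sum_of_injOn
    (fun t => GeneralLinearGroup.mkOfDetNeZero _ (by rw [hdet t]; exact t.1.2.ne_zero)) ?_
    (by simp) ?_ ?_
  · rintro t - s - h
    have h' := congrArg (fun g : GL (Fin 2) k => (g : Matrix (Fin 2) (Fin 2) k)) h
    have hd := congrArg Matrix.det h'
    have h00 := congrFun₂ h' 0 0
    have h01 := congrFun₂ h' 0 1
    have h11 := congrFun₂ h' 1 1
    simp only [GeneralLinearGroup.mkOfDetNeZero, GeneralLinearGroup.val_mk', hdet] at hd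
    simp [GeneralLinearGroup.mkOfDetNeZero] at h00 h01 h11
    obtain ⟨⟨⟨u, v⟩, w⟩, x⟩ := t
    obtain ⟨⟨⟨u', v'⟩, w'⟩, x'⟩ := s
    obtain rfl : u = u' := Units.ext h00
    obtain rfl : v = v' := Units.ext h01
    obtain rfl : w = w' := Units.ext hd
    have hu := u.ne_zero
    have hw := w.ne_zero
    have : x = x' := by
      simpa [div_left_inj' hu, hw] using h11
    rw [this]
  · intro g _ hg
    have hw : g.1.det ≠ 0 := g.det_ne_zero
    have h0 : g.1 0 0 = 0 ∨ g.1 0 1 = 0 := by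
      by_contra! h
      refine hg ⟨⟨⟨⟨Units.mk0 _ h.1, Units.mk0 _ h.2⟩, Units.mk0 _ hw⟩,
        g.1 0 0 * g.1 1 1 / g.1.det⟩, by simp, ?_⟩
      have h1 := h.1
      have h2 := h.2
      ext a c
      fin_cases a <;> fin_cases c <;> simp [GeneralLinearGroup.mkOfDetNeZero]
      · field_simp
        rw [det_fin_two]
        ring
      · field_simp
    -- This product is `-uv / det g`, so its power `q - 1` is the indicator of `uv ≠ 0`.
    have : g.1 0 0 * (g⁻¹).1 0 1 = 0 := by
      rw [Matrix.coe_units_inv, Matrix.inv_def, Matrix.adjugate_fin_two]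
      rcases h0 with h0 | h0 <;> simp [h0]
    rw [this, zero_pow (by omega), zero_mul]
  · rintro t -
    rw [Matrix.coe_units_inv]
    simp only [GeneralLinearGroup.mkOfDetNeZero, GeneralLinearGroup.val_mk', Matrix.inv_def, hdet,
      Matrix.adjugate_fin_two]
    obtain ⟨⟨⟨u, v⟩, w⟩, x⟩ := t
    have hu := u.ne_zero
    have hv := v.ne_zero
    have hw := w.ne_zero
    rw [FiniteField.pow_card_sub_one_eq_one _ (by simp), one_mul]
    congr 2 <;> simp <;> field_simp
    ring

end FiniteField

theorem not_surjective_rho {k : Type*} [Field k] [Fintype k] {V : Type*} [AddCommGroup V]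
    [Module k V] (hV : finrank k V = 2) {r : ℕ} (hr : 2 * Fintype.card k ≤ r) :
    ¬ Function.Surjective (rho k V r) := by
  classical
  intro hsurj
  have hq : 1 < Fintype.card k := Fintype.one_lt_card
  have : FiniteDimensional k V := FiniteDimensional.of_finrank_pos (by omega)
  let b : Basis (Fin 2) k V := finBasisOfFinrankEq k V hV
  obtain ⟨i, j, hij, hsum⟩ := exists_sum_pow_mul_pow_eq_neg_one (k := k)
    (n := r - (Fintype.card k - 1)) (by omega)
  obtain rfl : r = (Fintype.card k - 1) + (i + j) := by omega
  -- With target index constantly `0`, the blocks of lengths `q - 1`, `i`, `j` produce the three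
  -- powers in `sum_GL_two`.
  let I : Fin ((Fintype.card k - 1) + (i + j)) → Fin 2 :=
    Fin.append (fun _ => 0) (Fin.append (fun _ => 0) (fun _ => 1))
  let L : Fin ((Fintype.card k - 1) + (i + j)) → Fin 2 :=
    Fin.append (fun _ => 1) (fun _ => 0)
  obtain ⟨x, hx⟩ := hsurj (average (basisGL b) ((tensorCoord b I).smulRight
    (PiTensorProduct.tprod k fun a => b (I a))))
  have hL : ∀ σ : Equiv.Perm (Fin ((Fintype.card k - 1) + (i + j))), L ∘ σ ≠ fun _ => 0 := by
    intro σ h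
    have h1 := congrFun h (σ.symm (Fin.castAdd _ ⟨0, by omega⟩))
    rw [Function.comp_apply, Equiv.apply_symm_apply] at h1
    simp only [L, Fin.append_left] at h1
    exact one_ne_zero h1
  have h0 := tensorCoord_rho_eq_zero b hL x
  rw [hx, tensorCoord_average] at h0
  simp only [Fin.prod_univ_add, I, L, Fin.append_left, Fin.append_right, Finset.prod_const,
    Finset.card_univ, Fintype.card_fin] at h0
  rw [sum_GL_two, hsum] at h0
  simp at h0

end SchurWeyl

theorem mainTheorem5 (p : ℕ) [Fact p.Prime] :
    ∃ r₀ : ℕ, ∀ (V : Type*) [AddCommGroup V] [Module (ZMod p) V],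
      Module.finrank (ZMod p) V = 2 →
        ∀ r : ℕ, r₀ ≤ r → ¬ Function.Surjective (SchurWeyl.rho (ZMod p) V r) :=
  ⟨2 * p, fun _ _ _ hV _ hr => SchurWeyl.not_surjective_rho hV (by rwa [ZMod.card])⟩
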